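/- Let $k,H\ge 1$ be integers and $B,L>0$. For a Markov decision process $\mathcal M$ with finite nonempty state space $\mathcal S$, finite nonempty action space $\mathcal A$, horizon $H$ and initial distribution $\rho$, and a feature map $\phi:\mathcal S\times\mathcal A\to\mathbb R^d$ with $\|\phi(s,a)\|_2\le L$, consider $k$ labelers with reward functions $r_{\theta_i}(s,a)=\langle\theta_i,\phi(s,a)\rangle$, $\|\theta_i\|_2\le B$. For a (stochastic, history-independent) policy $\pi$ let $J_{\theta}(\pi)$ be the expected total reward over the $H$ steps for $r_\theta$ with initial state drawn from $\rho$, and let $W_\theta(\pi)=\frac1k\sum_{i=1}^kJ_{\theta_i}(\pi)$ for $\theta=(\theta_1,\dots,\theta_k)$. Each labeler $i$ is given $n$ fixed examples $(s^{i,j},\tau_0^{i,j},\tau_1^{i,j})$, $j\le n$, each an initial state with two subsequent trajectories. When labeler $i$ reports according to a parameter $\vartheta\in\mathbb R^d$, the labels $o^{i,j}\in\{0,1\}$ are drawn independently from the Bradley--Terry model $$\mathbb P_{\vartheta}(o=0\mid s,\tau_0,\tau_1)=\frac{\exp(r_{\vartheta}(s,\tau_0))}{\exp(r_{\vartheta}(s,\tau_0))+\exp(r_{\vartheta}(s,\tau_1))},$$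 where $r_\vartheta(s,\tau)$ is the total reward of trajectory $\tau$ from initial state $s$. An RLHF algorithm $\hat\pi$ maps the labeled datasets $\mathcal D=(\mathcal D_1,\dots,\mathcal D_k)$ to a policy $\hat\pi(\mathcal D)$. It is strategyproof on the given examples if for every labeler $i$, all labels of the other labelers (held fixed), every true parameter $\theta_i^*$ and every report $\tilde\theta_i\ne\theta_i^*$ (both of norm at most $B$), the expectation of $J_{\theta_i^*}(\hat\pi(\mathcal D))$ over labeler $i$'s labels is at least as large when they are drawn from $\mathbb P_{\theta_i^*}$ as when they are drawn from $\mathbb P_{\tilde\theta_i}$. Then the worst-case approximation ratio of any strategyproof RLHF algorithm is at most $1/k$. More precisely, for all $k,H\ge1$ and $B,L>0$ there are such an $\mathcal M$, a dimension $d$ and a feature map $\phi$ such that for every $n\ge0$, every choice of the examples and every RLHF algorithm $\hat\pi$ that is strategyproof on these examples, there are parameters $\theta=(\theta_1,\dots,\theta_k)$ with $\|\theta_i\|_2\le B$ and $r_{\theta_i}\ge0$ for all $i$, for which a policy $\pi^*$ maximizing $W_\theta$ exists, $W_\theta(\pi^*)>0$, and $$\mathbb E\left[\frac{W_\theta(\hat\pi(\mathcal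 D))}{W_\theta(\pi^*)}\right]\le\frac1k,$$ where the expectation is over truthful data $\mathcal D$: all labels are independent, and labeler $i$'s labels are drawn from $\mathbb P_{\theta_i}$. -/

import Mathlib

noncomputable section

namespace RLHF

/-- A finite-horizon Markov decision process without reward function, with finite state space `S`
and finite action space `A`. Probability distributions are points of the standard simplex. Steps
are indexed by `Fin H`, so the first step is `0`. -/
structure MDP (S A : Type) [Fintype S] [Fintype A] (H : ℕ) where
  /-- the initial state distribution -/
  initial : stdSimplex ℝ S
  /-- `transition h s a` is the law of the state at step `h + 1` -/
  transition : Fin H → S → A → stdSimplex ℝ S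

/-- History-independent (stochastic, time-dependent) policies. -/
abbrev Policy (S A : Type) [Fintype A] (H : ℕ) : Type := Fin H → S → stdSimplex ℝ A

/-- A trajectory `(a₁, s₂, a₂, …, s_H, a_H)` following a given initial state: the `H` actions,
and the `H - 1` states after the initial one. -/
abbrev Trajectory (S A : Type) (H : ℕ) : Type := (Fin H → A) × (Fin (H - 1) → S)

/-- The parameter space and the feature space `ℝ^d`, with the Euclidean norm. -/
abbrev Param (d : ℕ) : Type := EuclideanSpace ℝ (Fin d)

/-- The state visited at step `h` by trajectory `τ` with initial state `s`. -/
def stateAt {S A : Type} {H : ℕ} (s : S) (τ : Trajectory S A H) (h : Fin H) : S :=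
  if hh : h.val = 0 then s else τ.2 ⟨h.val - 1, by omega⟩

/-- The linear reward `r_θ(s, a) = ⟨θ, φ(s, a)⟩`. -/
def reward {S A : Type} {d : ℕ} (φ : S → A → Param d) (θ : Param d) (s : S) (a : A) : ℝ :=
  inner ℝ θ (φ s a)

/-- The total reward of a trajectory with initial state `s`. -/
def trajReward {S A : Type} {H d : ℕ} (φ : S → A → Param d) (θ : Param d)
    (s : S) (τ : Trajectory S A H) : ℝ :=
  ∑ h : Fin H, reward φ θ (stateAt s τ h) (τ.1 h)

/-- The probability of the trajectory `τ` under policy `π`, given the initial state `s`. -/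
def trajProb {S A : Type} [Fintype S] [Fintype A] {H : ℕ} (M : MDP S A H) (π : Policy S A H)
    (s : S) (τ : Trajectory S A H) : ℝ :=
  (∏ h : Fin H, (π h (stateAt s τ h)).1 (τ.1 h)) *
    ∏ h : Fin (H - 1),
      (M.transition ⟨h.val, by omega⟩ (stateAt s τ ⟨h.val, by omega⟩)
        (τ.1 ⟨h.val, by omega⟩)).1 (τ.2 h)

/-- The expected return of `π` from the initial state `s`, for the reward `r_θ`. -/
def value {S A : Type} [Fintype S] [Fintype A] {H d : ℕ} (M : MDP S A H)
    (φ : S → A → Param d) (θ : Param d) (π : Policy S A H) (s : S) : ℝ :=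
  ∑ τ : Trajectory S A H, trajProb M π s τ * trajReward φ θ s τ

/-- The utility `J(ρ, π)` of a labeler with reward parameter `θ`. -/
def utility {S A : Type} [Fintype S] [Fintype A] {H d : ℕ} (M : MDP S A H)
    (φ : S → A → Param d) (θ : Param d) (π : Policy S A H) : ℝ :=
  ∑ s : S, M.initial.1 s * value M φ θ π s

/-- The average social welfare of `π`, where `θ i` is the reward parameter of labeler `i`. -/
def welfare {S A : Type} [Fintype S] [Fintype A] {H d k : ℕ} (M : MDP S A H)
    (φ : S → A → Param d) (θ : Fin k → Param d) (π : Policy S A H) : ℝ :=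
  (1 / (k : ℝ)) * ∑ i : Fin k, utility M φ (θ i) π

/-- `π` maximizes the average social welfare over all policies. -/
def IsOptimal {S A : Type} [Fintype S] [Fintype A] {H d k : ℕ} (M : MDP S A H)
    (φ : S → A → Param d) (θ : Fin k → Param d) (π : Policy S A H) : Prop :=
  ∀ π' : Policy S A H, welfare M φ θ π' ≤ welfare M φ θ π

/-- The approximation ratio of `π` relative to the policy `πopt` (to be used with an optimal policy
`πopt` of positive welfare). -/
def approxRatio {S A : Type} [Fintype S] [Fintype A] {H d k : ℕ} (M : MDP S A H)
    (φ : S → A → Param d) (θ : Fin k → Param d) (πopt π : Policy S A H) : ℝ :=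
  welfare M φ θ π / welfare M φ θ πopt

/-- An unlabeled example: an initial state and two subsequent trajectories. -/
structure Query (S A : Type) (H : ℕ) where
  init : S
  traj0 : Trajectory S A H
  traj1 : Trajectory S A H

/-- The Bradley-Terry probability of the label `o`; the label `0` means that `traj0` is
preferred, the label `1` that `traj1` is. -/
def btProb {S A : Type} {H d : ℕ} (φ : S → A → Param d) (θ : Param d) (q : Query S A H)
    (o : Fin 2) : ℝ :=
  (if o = 0 then Real.exp (trajReward φ θ q.init q.traj0)
    else Real.exp (trajReward φ θ q.init q.traj1)) /
  (Real.exp (trajReward φ θ q.init q.traj0) + Real.exp (trajReward φ θ q.init q.traj1))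

/-- The preference data of one labeler: `n` labeled examples. -/
abbrev Dataset (S A : Type) (H n : ℕ) : Type := Fin n → Query S A H × Fin 2

/-- The probability that a labeler with reward parameter `θ` answers the `n` queries `q` with the
labels `o`, the labels being drawn independently. -/
def labelProb {S A : Type} {H d n : ℕ} (φ : S → A → Param d) (θ : Param d)
    (q : Fin n → Query S A H) (o : Fin n → Fin 2) : ℝ :=
  ∏ j : Fin n, btProb φ θ (q j) (o j)

/-- The datasets of all labelers, formed from their queries and their labels. -/
def mkData {S A : Type} {H k n : ℕ} (q : Fin k → Fin n → Query S A H)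
    (o : Fin k → Fin n → Fin 2) : Fin k → Dataset S A H n :=
  fun i j => (q i j, o i j)

/-- An RLHF algorithm maps the datasets of the `k` labelers to a policy. -/
abbrev Algorithm (S A : Type) [Fintype A] (H k n : ℕ) : Type :=
  (Fin k → Dataset S A H n) → Policy S A H

/-- The expected utility of labeler `i`, whose true parameter is `θ`, if `i` draws labels from the
Bradley-Terry model with parameter `θrep` and the labels of the others are those in `o` (the entry
`o i` is not used). -/
def expectedUtility {S A : Type} [Fintype S] [Fintype A] {H d k n : ℕ} (M : MDP S A H)
    (φ : S → A → Param d) (q : Fin k → Fin n → Query S A H) (alg : Algorithm S A H k n)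
    (i : Fin k) (o : Fin k → Fin n → Fin 2) (θ θrep : Param d) : ℝ :=
  ∑ oi : Fin n → Fin 2,
    labelProb φ θrep (q i) oi * utility M φ θ (alg (mkData q (Function.update o i oi)))

/-- Strategyproofness on the queries `q`: for every labeler, every true parameter and all labels
of the others, no other reported parameter gives the labeler a higher expected utility. True and
reported parameters range over the parameter space `{θ | ‖θ‖ ≤ B}`; an algorithm that withstands
a larger class of deviations is strategyproof in this sense too. -/
def IsStrategyproof {S A : Type} [Fintype S] [Fintype A] {H d k n : ℕ} (M : MDP S A H)
    (φ : S → A → Param d) (B : ℝ) (q : Fin k → Fin n → Query S A H)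
    (alg : Algorithm S A H k n) : Prop :=
  ∀ (i : Fin k) (o : Fin k → Fin n → Fin 2) (θ θrep : Param d),
    ‖θ‖ ≤ B → ‖θrep‖ ≤ B → θrep ≠ θ →
      expectedUtility M φ q alg i o θ θrep ≤ expectedUtility M φ q alg i o θ θ

/-- The expectation of `f (π̂(D))` if every labeler `i` reports truthfully, i.e. draws labels from
the Bradley-Terry model with parameter `θ i`, independently of the other labelers. -/
def truthfulExpectation {S A : Type} [Fintype A] {H d k n : ℕ}
    (φ : S → A → Param d) (q : Fin k → Fin n → Query S A H) (alg : Algorithm S A H k n)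
    (θ : Fin k → Param d) (f : Policy S A H → ℝ) : ℝ :=
  ∑ o : Fin k → Fin n → Fin 2,
    (∏ i : Fin k, labelProb φ (θ i) (q i) (o i)) * f (alg (mkData q o))

end RLHF

end

/-! Strategyproofness forces reports to be irrelevant in expectation. Utility is linear in the true
parameter, so `t • θ` with `0 < t < 1` ranks outcomes as `θ` does, and its truthful report `t • θ`
is therefore optimal for `θ` too. Letting `t → 0`, the report `0` is optimal; applying this to `-θ`
shows that it is also worst, so all reports tie (`IsStrategyproof.expectedUtility_eq_zero`).
Changing one labeler at a time, the expected utility for any fixed `θ` is the same as under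
uniformly random labels (`IsStrategyproof.truthfulExpectation_utility`).

In a one-state process with `k` actions and orthogonal features, the utilities for the `k`
parameters `B • e_a` sum to `H * (B * L)`, so under random labels some `a` gets at most a `1 / k`
share. If all labelers have that parameter, always playing `a` earns `H * (B * L)`. -/

noncomputable section

namespace RLHF

/-! ### Irrelevance of a single labeler's report -/

section General

variable {S A : Type} [Fintype S] [Fintype A] {H d k n : ℕ}

omit [Fintype S] [Fintype A] in
lemma trajReward_smul (φ : S → A → Param d) (c : ℝ) (θ : Param d) (s : S)
    (τ : Trajectory S A H) : trajReward φ (c • θ) s τ = c * trajReward φ θ s τ := by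
  simp [trajReward, reward, inner_smul_left, Finset.mul_sum]

lemma utility_smul (M : MDP S A H) (φ : S → A → Param d) (c : ℝ) (θ : Param d)
    (π : Policy S A H) : utility M φ (c • θ) π = c * utility M φ θ π := by
  simp only [utility, value, trajReward_smul, Finset.mul_sum]
  exact Finset.sum_congr rfl fun _ _ => Finset.sum_congr rfl fun _ _ => by ring

lemma expectedUtility_smul (M : MDP S A H) (φ : S → A → Param d)
    (q : Fin k → Fin n → Query S A H) (alg : Algorithm S A H k n) (i : Fin k)
    (o : Fin k → Fin n → Fin 2) (c : ℝ) (θ θrep : Param d) :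
    expectedUtility M φ q alg i o (c • θ) θrep = c * expectedUtility M φ q alg i o θ θrep := by
  simp only [expectedUtility, utility_smul, Finset.mul_sum]
  exact Finset.sum_congr rfl fun _ _ => by ring

omit [Fintype S] [Fintype A] in
lemma continuous_trajReward (φ : S → A → Param d) (s : S) (τ : Trajectory S A H) :
    Continuous fun θ => trajReward φ θ s τ := by
  unfold trajReward reward
  fun_prop

omit [Fintype S] [Fintype A] in
lemma continuous_btProb (φ : S → A → Param d) (q : Query S A H) (o : Fin 2) :
    Continuous fun θ => btProb φ θ q o := by
  have h0 := continuous_trajReward φ q.init q.traj0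
  have h1 := continuous_trajReward φ q.init q.traj1
  unfold btProb
  refine Continuous.div ?_ (by fun_prop) fun θ => by positivity
  split_ifs <;> fun_prop

lemma continuous_expectedUtility_report (M : MDP S A H) (φ : S → A → Param d)
    (q : Fin k → Fin n → Query S A H) (alg : Algorithm S A H k n) (i : Fin k)
    (o : Fin k → Fin n → Fin 2) (θ : Param d) :
    Continuous fun θrep => expectedUtility M φ q alg i o θ θrep := by
  unfold expectedUtility labelProb
  exact continuous_finsetSum _ fun oi _ =>
    (continuous_finsetProd _ fun j _ => continuous_btProb φ (q i j) (oi j)).mul continuous_const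

/-- Under strategyproofness no report beats the report `0`: a labeler with parameter `t • θ` has the
same preferences as one with parameter `θ`, and the label law is continuous at `0`. -/
lemma IsStrategyproof.expectedUtility_le_zero {M : MDP S A H} {φ : S → A → Param d} {B : ℝ}
    {q : Fin k → Fin n → Query S A H} {alg : Algorithm S A H k n}
    (h : IsStrategyproof M φ B q alg) (i : Fin k) (o : Fin k → Fin n → Fin 2)
    {θ θrep : Param d} (hθ : ‖θ‖ ≤ B) (hrep : ‖θrep‖ ≤ B) :
    expectedUtility M φ q alg i o θ θrep ≤ expectedUtility M φ q alg i o θ 0 := by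
  have hc : Continuous fun t : ℝ => expectedUtility M φ q alg i o θ (t • θ) :=
    (continuous_expectedUtility_report M φ q alg i o θ).comp (by fun_prop)
  have hlim : Filter.Tendsto (fun t : ℝ => expectedUtility M φ q alg i o θ (t • θ))
      (nhdsWithin 0 (Set.Ioi 0)) (nhds (expectedUtility M φ q alg i o θ 0)) := by
    simpa using (hc.tendsto 0).mono_left nhdsWithin_le_nhds
  refine ge_of_tendsto hlim ?_
  filter_upwards [Ioo_mem_nhdsGT (zero_lt_one' ℝ)] with t ht
  have hnorm : ‖t • θ‖ ≤ B := by
    rw [norm_smul, Real.norm_of_nonneg ht.1.le]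
    exact (mul_le_of_le_one_left (norm_nonneg _) ht.2.le).trans hθ
  have key : expectedUtility M φ q alg i o (t • θ) θrep
      ≤ expectedUtility M φ q alg i o (t • θ) (t • θ) := by
    -- `IsStrategyproof` only compares distinct parameters.
    rcases eq_or_ne θrep (t • θ) with rfl | hne
    · exact le_rfl
    · exact h i o _ _ hnorm hrep hne
  rw [expectedUtility_smul, expectedUtility_smul] at key
  exact le_of_mul_le_mul_left key ht.1

/-- A labeler's report does not affect the expected utilities under a strategyproof algorithm. -/
lemma IsStrategyproof.expectedUtility_eq_zero {M : MDP S A H} {φ : S → A → Param d} {B : ℝ}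
    {q : Fin k → Fin n → Query S A H} {alg : Algorithm S A H k n}
    (h : IsStrategyproof M φ B q alg) (i : Fin k) (o : Fin k → Fin n → Fin 2)
    {θ θrep : Param d} (hθ : ‖θ‖ ≤ B) (hrep : ‖θrep‖ ≤ B) :
    expectedUtility M φ q alg i o θ θrep = expectedUtility M φ q alg i o θ 0 := by
  refine le_antisymm (h.expectedUtility_le_zero i o hθ hrep) ?_
  -- The norm ball is symmetric, and negating the true parameter reverses the inequality.
  have hneg := h.expectedUtility_le_zero (θ := (-1 : ℝ) • θ) i o (by simpa using hθ) hrep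
  rw [expectedUtility_smul, expectedUtility_smul] at hneg
  linarith

end General

/-! ### Changing all reports -/

/-- Two product weights give the same weighted sum of `f` if they do so in each coordinate, all
other coordinates being fixed. -/
lemma sum_prod_mul_eq_of_update {ι X : Type*} [Fintype ι] [DecidableEq ι] [Fintype X]
    (v w : ι → X → ℝ) (f : (ι → X) → ℝ)
    (h : ∀ i o, ∑ x, v i x * f (Function.update o i x) = ∑ x, w i x * f (Function.update o i x)) :
    ∑ o : ι → X, (∏ i, v i (o i)) * f o = ∑ o : ι → X, (∏ i, w i (o i)) * f o := by
  classical
  have split : ∀ (i : ι) (u : ι → X → ℝ), ∑ o : ι → X, (∏ j, u j (o j)) * f o =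
      ∑ r : {j // j ≠ i} → X, (∏ j : {j // j ≠ i}, u j (r j)) *
        ∑ x, u i x * f ((Equiv.funSplitAt i X).symm (x, r)) := by
    intro i u
    rw [← (Equiv.funSplitAt i X).symm.sum_comp, Fintype.sum_prod_type, Finset.sum_comm]
    refine Finset.sum_congr rfl fun r _ => ?_
    rw [Finset.mul_sum]
    refine Finset.sum_congr rfl fun x _ => ?_
    rw [Fintype.prod_eq_mul_prod_subtype_ne _ i]
    have : ∀ j : {j // j ≠ i}, (Equiv.funSplitAt i X).symm (x, r) j = r j := fun j => by
      simp [Equiv.funSplitAt, Equiv.piSplitAt, j.2]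
    have hi : (Equiv.funSplitAt i X).symm (x, r) i = x := by
      simp [Equiv.funSplitAt, Equiv.piSplitAt]
    simp only [this, hi]
    ring
  -- Hybrid argument: weights `v` on `s` and `w` off `s`, so each insertion changes one coordinate.
  have step : ∀ s : Finset ι,
      ∑ o : ι → X, (∏ i, (s.piecewise v w) i (o i)) * f o =
        ∑ o : ι → X, (∏ i, w i (o i)) * f o := by
    intro s
    induction s using Finset.induction_on with
    | empty => simp
    | insert i s hi ih =>
      rw [← ih, split i, split i]
      refine Finset.sum_congr rfl fun r _ => ?_
      congr 1
      · refine Finset.prod_congr rfl fun j _ => ?_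
        simp [Finset.piecewise, Finset.mem_insert, j.2]
      · cases isEmpty_or_nonempty X with
        | inl hX => simp
        | inr hX =>
          have hupd : ∀ x, (Equiv.funSplitAt i X).symm (x, r) =
              Function.update ((Equiv.funSplitAt i X).symm (Classical.arbitrary X, r)) i x := by
            intro x
            funext j
            by_cases hj : j = i
            · subst hj; simp [Equiv.funSplitAt, Equiv.piSplitAt]
            · simp [Equiv.funSplitAt, Equiv.piSplitAt, hj]
          have hv : (insert i s).piecewise v w i = v i := by simp
          have hw : s.piecewise v w i = w i := by simp [hi]
          have := h i ((Equiv.funSplitAt i X).symm (Classical.arbitrary X, r))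
          simp only [← hupd] at this
          rw [hv, hw, this]
  simpa using step Finset.univ

section Expectation

variable {S A : Type} [Fintype S] [Fintype A] {H d k n : ℕ}

/-- The evaluating parameter `θ` is decoupled from the reports `η`: at each coordinate change, `θ`
serves as the true parameter of the labeler concerned. -/
lemma IsStrategyproof.truthfulExpectation_utility {M : MDP S A H} {φ : S → A → Param d} {B : ℝ}
    {q : Fin k → Fin n → Query S A H} {alg : Algorithm S A H k n}
    (h : IsStrategyproof M φ B q alg) {θ : Param d} (hθ : ‖θ‖ ≤ B) (η : Fin k → Param d)
    (hη : ∀ i, ‖η i‖ ≤ B) :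
    truthfulExpectation φ q alg η (utility M φ θ) =
      truthfulExpectation φ q alg (fun _ => 0) (utility M φ θ) :=
  sum_prod_mul_eq_of_update (fun i => labelProb φ (η i) (q i)) (fun i => labelProb φ 0 (q i))
    (fun o => utility M φ θ (alg (mkData q o)))
    fun i o => h.expectedUtility_eq_zero i o hθ (hη i)

omit [Fintype S] [Fintype A] in
lemma sum_labelProb (φ : S → A → Param d) (θ : Param d) (q : Fin n → Query S A H) :
    ∑ o, labelProb φ θ q o = 1 := by
  classical
  unfold labelProb
  rw [← Fintype.prod_sum (fun j x => btProb φ θ (q j) x)]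
  refine Finset.prod_eq_one fun j _ => ?_
  rw [Fin.sum_univ_two]
  simp only [btProb, if_true, one_ne_zero, if_false]
  rw [← add_div, div_self (by positivity)]

omit [Fintype S] in
lemma truthfulExpectation_const (φ : S → A → Param d) (q : Fin k → Fin n → Query S A H)
    (alg : Algorithm S A H k n) (θ : Fin k → Param d) (c : ℝ) :
    truthfulExpectation φ q alg θ (fun _ => c) = c := by
  classical
  unfold truthfulExpectation
  rw [← Finset.sum_mul, ← Fintype.prod_sum (fun i x => labelProb φ (θ i) (q i) x)]
  simp [sum_labelProb]

omit [Fintype S] in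
lemma truthfulExpectation_sum {ι : Type*} (s : Finset ι) (φ : S → A → Param d)
    (q : Fin k → Fin n → Query S A H) (alg : Algorithm S A H k n) (θ : Fin k → Param d)
    (f : ι → Policy S A H → ℝ) :
    truthfulExpectation φ q alg θ (fun π => ∑ a ∈ s, f a π) =
      ∑ a ∈ s, truthfulExpectation φ q alg θ (f a) := by
  unfold truthfulExpectation
  simp only [Finset.mul_sum]
  exact Finset.sum_comm

omit [Fintype S] in
lemma truthfulExpectation_div (φ : S → A → Param d) (q : Fin k → Fin n → Query S A H)
    (alg : Algorithm S A H k n) (θ : Fin k → Param d) (f : Policy S A H → ℝ) (c : ℝ) :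
    truthfulExpectation φ q alg θ (fun π => f π / c) = truthfulExpectation φ q alg θ f / c := by
  unfold truthfulExpectation
  rw [Finset.sum_div]
  exact Finset.sum_congr rfl fun _ _ => by ring

lemma welfare_const (hk : k ≠ 0) (M : MDP S A H) (φ : S → A → Param d) (θ : Param d)
    (π : Policy S A H) : welfare M φ (fun _ : Fin k => θ) π = utility M φ θ π := by
  have : (k : ℝ) ≠ 0 := by exact_mod_cast hk
  simp [welfare, this]

end Expectation

/-- The mean of an additive functional under a product distribution. -/
lemma sum_prod_mul_sum {ι A : Type*} [Fintype ι] [DecidableEq ι] [Fintype A]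
    (p : ι → A → ℝ) (hp : ∀ h, ∑ a, p h a = 1) (g : A → ℝ) :
    ∑ f : ι → A, (∏ h, p h (f h)) * ∑ h, g (f h) = ∑ h, ∑ a, p h a * g a := by
  simp only [Finset.mul_sum]
  rw [Finset.sum_comm]
  refine Finset.sum_congr rfl fun h₀ _ => ?_
  -- Absorbing `g` into the factor at `h₀` lets the sum factor over coordinates; the others sum to
  -- one.
  have hf : ∀ f : ι → A, (∏ h, p h (f h)) * g (f h₀) =
      ∏ h, p h (f h) * (if h = h₀ then g (f h) else 1) := by
    intro f
    rw [Finset.prod_mul_distrib, Finset.prod_ite_eq' Finset.univ h₀ fun h => g (f h)]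
    simp
  simp only [hf]
  rw [← Fintype.prod_sum fun h a => p h a * (if h = h₀ then g a else 1),
    Finset.prod_eq_single h₀]
  · simp
  · intro h _ hne
    simp [hne, hp]
  · simp

/-! ### The one-state process with orthogonal features -/

section Bandit

variable {k H : ℕ}

/-- The decision process with a single state. -/
def singleState (A : Type) [Fintype A] (H : ℕ) : MDP Unit A H where
  initial := ⟨fun _ => 1, fun _ => zero_le_one, by simp⟩
  transition _ _ _ := ⟨fun _ => 1, fun _ => zero_le_one, by simp⟩

/-- The features `φ(a) = L • e_a`. -/
def scaledBasis (k : ℕ) (L : ℝ) : Unit → Fin k → Param k :=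
  fun _ a => EuclideanSpace.single a L

lemma reward_scaledBasis (L B : ℝ) (a b : Fin k) (s : Unit) :
    reward (scaledBasis k L) (EuclideanSpace.single a B) s b = if b = a then B * L else 0 := by
  rw [reward, scaledBasis, EuclideanSpace.inner_single_left]
  by_cases h : b = a
  · simp [h]
  · simp [h, Ne.symm h]

lemma utility_singleState (L B : ℝ) (a : Fin k) (π : Policy Unit (Fin k) H) :
    utility (singleState (Fin k) H) (scaledBasis k L) (EuclideanSpace.single a B) π =
      ∑ h, (π h ()).1 a * (B * L) := by
  have := sum_prod_mul_sum (fun h => (π h ()).1) (fun h => (π h ()).2.2)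
    (fun b => if b = a then B * L else 0)
  simp only [mul_ite, mul_zero, Finset.sum_ite_eq', Finset.mem_univ, if_true] at this
  rw [← this]
  simp [utility, value, trajProb, trajReward, singleState, reward_scaledBasis,
    Fintype.sum_prod_type]

lemma sum_utility_singleState (L B : ℝ) (π : Policy Unit (Fin k) H) :
    ∑ a, utility (singleState (Fin k) H) (scaledBasis k L) (EuclideanSpace.single a B) π =
      H * (B * L) := by
  simp only [utility_singleState]
  rw [Finset.sum_comm]
  have (h : Fin H) : ∑ a, (π h ()).1 a = 1 := (π h ()).2.2
  simp [← Finset.sum_mul, this]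

/-- The policy that always takes action `a`. -/
def constPolicy (a : Fin k) : Policy Unit (Fin k) H :=
  fun _ _ => ⟨Pi.single a 1, single_mem_stdSimplex ℝ a⟩

lemma utility_constPolicy (L B : ℝ) (a : Fin k) :
    utility (singleState (Fin k) H) (scaledBasis k L) (EuclideanSpace.single a B)
      (constPolicy a) = H * (B * L) := by
  simp [utility_singleState, constPolicy]

lemma utility_singleState_le {L B : ℝ} (hBL : 0 ≤ B * L) (a : Fin k)
    (π : Policy Unit (Fin k) H) :
    utility (singleState (Fin k) H) (scaledBasis k L) (EuclideanSpace.single a B) π ≤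
      H * (B * L) := by
  rw [utility_singleState]
  calc ∑ h, (π h ()).1 a * (B * L) ≤ ∑ _h : Fin H, B * L :=
        Finset.sum_le_sum fun h _ => mul_le_of_le_one_left hBL
          ((Finset.single_le_sum (fun b _ => (π h ()).2.1 b) (Finset.mem_univ a)).trans_eq
            (π h ()).2.2)
    _ = H * (B * L) := by simp

end Bandit

end RLHF

end

theorem mainTheorem7 (k H : ℕ) (hk : 1 ≤ k) (hH : 1 ≤ H) (B L : ℝ) (hB : 0 < B) (hL : 0 < L) :
    ∃ (S A : Type) (_ : Fintype S) (_ : Fintype A) (_ : Nonempty S) (_ : Nonempty A) (d : ℕ)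
      (M : RLHF.MDP S A H) (φ : S → A → RLHF.Param d),
      (∀ s a, ‖φ s a‖ ≤ L) ∧
      ∀ (n : ℕ) (q : Fin k → Fin n → RLHF.Query S A H) (alg : RLHF.Algorithm S A H k n),
        RLHF.IsStrategyproof M φ B q alg →
        ∃ θ : Fin k → RLHF.Param d,
          (∀ i, ‖θ i‖ ≤ B) ∧
          (∀ i s a, 0 ≤ RLHF.reward φ (θ i) s a) ∧
          ∃ πopt : RLHF.Policy S A H,
            RLHF.IsOptimal M φ θ πopt ∧
            0 < RLHF.welfare M φ θ πopt ∧
            RLHF.truthfulExpectation φ q alg θ (RLHF.approxRatio M φ θ πopt) ≤ 1 / (k : ℝ) := by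
  open RLHF in
  have hk0 : k ≠ 0 := by omega
  have hkpos : (0 : ℝ) < k := by exact_mod_cast hk
  have hHpos : (0 : ℝ) < H := by exact_mod_cast hH
  have hBL : 0 < B * L := mul_pos hB hL
  have : Nonempty (Fin k) := ⟨⟨0, hk⟩⟩
  refine ⟨Unit, Fin k, inferInstance, inferInstance, inferInstance, this, k,
    singleState (Fin k) H, scaledBasis k L, fun s a => by simp [scaledBasis, abs_of_pos hL], ?_⟩
  intro n q alg hsp
  have hnorm : ∀ a : Fin k, ‖(EuclideanSpace.single a B : Param k)‖ ≤ B := fun a => by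
    simp [abs_of_pos hB]
  -- Pigeonhole under zero reports: this choice of `a` precedes, and does not depend on, the
  -- labelers' parameters.
  obtain ⟨a, ha⟩ : ∃ a : Fin k, truthfulExpectation (scaledBasis k L) q alg (fun _ => 0)
      (utility (singleState (Fin k) H) (scaledBasis k L) (EuclideanSpace.single a B)) ≤
        H * (B * L) / k := by
    by_contra! hlt
    have hsum := Finset.sum_lt_sum_of_nonempty Finset.univ_nonempty fun a _ => hlt a
    rw [← truthfulExpectation_sum] at hsum
    simp only [sum_utility_singleState, truthfulExpectation_const] at hsum
    simp [mul_div_cancel₀ _ hkpos.ne'] at hsum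
  refine ⟨fun _ => EuclideanSpace.single a B, fun _ => hnorm a, fun _ s b => ?_,
    constPolicy a, fun π => ?_, ?_, ?_⟩
  · rw [reward_scaledBasis]
    split_ifs
    exacts [hBL.le, le_rfl]
  · rw [welfare_const hk0, welfare_const hk0, utility_constPolicy]
    exact utility_singleState_le hBL.le a π
  · rw [welfare_const hk0, utility_constPolicy]
    positivity
  · have hratio : approxRatio (singleState (Fin k) H) (scaledBasis k L)
        (fun _ : Fin k => EuclideanSpace.single a B) (constPolicy a) =
        fun π => utility (singleState (Fin k) H) (scaledBasis k L)
          (EuclideanSpace.single a B) π / (H * (B * L)) := by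
      funext π
      rw [approxRatio, welfare_const hk0, welfare_const hk0, utility_constPolicy]
    rw [hratio, truthfulExpectation_div, hsp.truthfulExpectation_utility (hnorm a) _
      fun _ => hnorm a, div_le_iff₀ (by positivity)]
    exact ha.trans_eq (by ring)
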